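/- All graphs are finite and simple. For a graph $G$ with vertex set $V=\{v_1,\dots,v_n\}$, its chromatic symmetric function is the formal power series $$\mathbf{X}_G=\sum_{\kappa} x_{\kappa(v_1)}x_{\kappa(v_2)}\cdots x_{\kappa(v_n)}$$ in countably many commuting variables $x_i$ ($i\in\mathbb{N}$), where $\kappa$ ranges over all proper colorings $\kappa\colon V\to\mathbb{N}$ of $G$. A graph is unicyclic if it contains exactly one cycle (as a subgraph); the size of a cycle is its number of vertices. If $G_1$ and $G_2$ are connected unicyclic graphs whose cycles have different sizes, then $\mathbf{X}_{G_1}\neq\mathbf{X}_{G_2}$. -/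

import Mathlib

noncomputable section

namespace SimpleGraph

/-- The exponent vector of the monomial `∏ v, x_{κ v}`: the variable `x_i` occurs with exponent
the number of vertices of colour `i`. -/
def colorExponent {V : Type*} [Fintype V] {G : SimpleGraph V} (κ : G.Coloring ℕ) : ℕ →₀ ℕ :=
  ∑ v : V, Finsupp.single (κ v) 1

/-- The chromatic symmetric function `∑_κ ∏_v x_{κ v}` of a finite simple graph, the sum being over
all proper colourings `κ : V → ℕ`, as a formal power series in the variables `x_0, x_1, …`:
the coefficient of a monomial is the (finite) number of proper colourings contributing it. -/
def chromaticSymmetricFunction {V : Type*} [Fintype V] (G : SimpleGraph V) : MvPowerSeries ℕ ℚ :=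
  fun d => (Nat.card {κ : G.Coloring ℕ // colorExponent κ = d} : ℚ)

/-- Only finitely many proper colourings contribute to a given monomial. -/
theorem finite_colorings_of_colorExponent {V : Type*} [Fintype V] (G : SimpleGraph V)
    (d : ℕ →₀ ℕ) : Finite {κ : G.Coloring ℕ // colorExponent κ = d} := by
  have h : ∀ (κ : {κ : G.Coloring ℕ // colorExponent κ = d}) (v : V), κ.1 v ∈ d.support := by
    rintro ⟨κ, rfl⟩ v
    have : 1 ≤ colorExponent κ (κ v) := by
      unfold colorExponent
      rw [Finsupp.finsetSum_apply]
      calc 1 = Finsupp.single (κ v) 1 (κ v) := by simp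
        _ ≤ _ := Finset.single_le_sum
          (f := fun w => (Finsupp.single (κ w) 1 : ℕ →₀ ℕ) (κ v))
          (fun _ _ => Nat.zero_le _) (Finset.mem_univ v)
    rw [Finsupp.mem_support_iff]
    exact Nat.one_le_iff_ne_zero.mp this
  refine Finite.of_injective
    (fun κ => (fun v => ⟨κ.1 v, h κ v⟩ :
      V → d.support)) ?_
  intro κ κ' hk
  apply Subtype.ext
  apply DFunLike.ext
  intro v
  exact congrArg Subtype.val (congrFun hk v)

open scoped MvPowerSeries.WithPiTopology in
/-- The defining expansion: the series is the (coefficientwise) sum over all proper colourings of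
the monomials `∏ v, x_{κ v}`. -/
theorem hasSum_chromaticSymmetricFunction {V : Type*} [Fintype V] (G : SimpleGraph V) :
    HasSum (fun κ : G.Coloring ℕ => ∏ v : V, (MvPowerSeries.X (κ v) : MvPowerSeries ℕ ℚ))
      G.chromaticSymmetricFunction := by
  classical
  have hm : ∀ κ : G.Coloring ℕ, ∏ v : V, (MvPowerSeries.X (κ v) : MvPowerSeries ℕ ℚ)
      = MvPowerSeries.monomial (colorExponent κ) 1 := by
    intro κ
    have h : ∀ s : Finset V, ∏ v ∈ s, (MvPowerSeries.X (κ v) : MvPowerSeries ℕ ℚ)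
        = MvPowerSeries.monomial (∑ v ∈ s, Finsupp.single (κ v) 1) 1 := by
      intro s
      induction s using Finset.induction_on with
      | empty => simp
      | insert a s ha ih =>
        rw [Finset.prod_insert ha, Finset.sum_insert ha, ih, MvPowerSeries.X,
          MvPowerSeries.monomial_mul_monomial, one_mul]
    exact h _
  rw [MvPowerSeries.WithPiTopology.hasSum_iff_hasSum_coeff]
  intro d
  have hfin : {κ : G.Coloring ℕ | colorExponent κ = d}.Finite :=
    Set.finite_coe_iff.mp (finite_colorings_of_colorExponent G d)
  have hc : MvPowerSeries.coeff d G.chromaticSymmetricFunction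
      = ∑ κ ∈ hfin.toFinset,
        MvPowerSeries.coeff d (∏ v : V, (MvPowerSeries.X (κ v) : MvPowerSeries ℕ ℚ)) := by
    rw [Finset.sum_congr rfl (g := fun _ => (1 : ℚ))]
    · rw [Finset.sum_const, nsmul_eq_mul, mul_one, ← Set.ncard_eq_toFinset_card _ hfin]
      rfl
    · intro κ hκ
      rw [hm, MvPowerSeries.coeff_monomial, if_pos]
      simpa [eq_comm] using hκ
  rw [hc]
  apply hasSum_sum_of_ne_finset_zero
  intro κ hκ
  rw [hm, MvPowerSeries.coeff_monomial, if_neg]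
  simpa [eq_comm] using hκ

/-- A subgraph that is a cycle, i.e. consists of the vertices and edges of a closed walk of
positive length that repeats neither an edge nor (apart from its endpoint) a vertex. -/
def Subgraph.IsCycleSubgraph {V : Type*} {G : SimpleGraph V} (C : G.Subgraph) : Prop :=
  ∃ (v : V) (w : G.Walk v v), w.IsCycle ∧ w.toSubgraph = C

/-- A graph is unicyclic if it contains exactly one cycle. -/
def IsUnicyclic {V : Type*} (G : SimpleGraph V) : Prop :=
  ∃! C : G.Subgraph, C.IsCycleSubgraph

end SimpleGraph

end

namespace SimpleGraph

/-- If a property of `ZMod 3`-colourings is invariant under shifting the colours of a set containing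
`a` but not `b`, then a third of the colourings with this property give `a` and `b` the same
colour. -/
theorem three_mul_card_filter_eq {V : Type*} [Fintype V] (K : Set V) {a b : V}
    (ha : a ∈ K) (hb : b ∉ K) (Q : (V → ZMod 3) → Prop)
    (hQ : ∀ f c, Q f → Q (f + K.indicator fun _ => c)) :
    3 * {f | Q f ∧ f a = f b}.ncard = {f | Q f}.ncard := by
  classical
  have hcard : ∀ c : ZMod 3, ((Finset.univ.filter Q).filter fun f => f a - f b = c).card =
      (Finset.univ.filter fun f => Q f ∧ f a = f b).card := by
    intro c
    refine Finset.card_nbij' (fun f => f + K.indicator fun _ => -c)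
      (fun f => f + K.indicator fun _ => c) ?_ ?_ ?_ ?_
    · intro f hf
      simp only [Finset.coe_filter, Finset.mem_filter, Finset.mem_univ, true_and,
        Set.mem_ofPred_eq] at hf ⊢
      refine ⟨hQ _ _ hf.1, ?_⟩
      simp only [Pi.add_apply, Set.indicator_of_mem ha, Set.indicator_of_notMem hb]
      linear_combination hf.2
    · intro f hf
      simp only [Finset.coe_filter, Finset.mem_filter, Finset.mem_univ, true_and,
        Set.mem_ofPred_eq] at hf ⊢
      refine ⟨hQ _ _ hf.1, ?_⟩
      simp only [Pi.add_apply, Set.indicator_of_mem ha, Set.indicator_of_notMem hb]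
      linear_combination hf.2
    · intro f _
      ext v
      by_cases hv : v ∈ K <;> simp [hv]
    · intro f _
      ext v
      by_cases hv : v ∈ K <;> simp [hv]
  have hsum := Finset.card_eq_sum_card_fiberwise (s := Finset.univ.filter Q)
    (f := fun f => f a - f b) (t := Finset.univ) (fun _ _ => Finset.mem_coe.2 (Finset.mem_univ _))
  have h1 : {f | Q f} = (Finset.univ.filter Q : Set (V → ZMod 3)) := by simp
  have h2 : {f | Q f ∧ f a = f b} =
      (Finset.univ.filter fun f => Q f ∧ f a = f b : Set (V → ZMod 3)) := by simp
  rw [h1, h2, Set.ncard_coe_finset, Set.ncard_coe_finset, hsum,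
    Finset.sum_congr rfl fun c _ => hcard c]
  simp [ZMod.card]

theorem ncard_setOf_and_add_ncard_setOf_and_not {α : Type*} [Finite α] (P Q : α → Prop) :
    {f | Q f ∧ P f}.ncard + {f | Q f ∧ ¬ P f}.ncard = {f | Q f}.ncard :=
  Set.ncard_inter_add_ncard_sdiff_eq_ncard {f | Q f} {f | P f} (Set.toFinite _)

theorem three_mul_card_filter_ne {V : Type*} [Fintype V] (K : Set V) {a b : V}
    (ha : a ∈ K) (hb : b ∉ K) (Q : (V → ZMod 3) → Prop)
    (hQ : ∀ f c, Q f → Q (f + K.indicator fun _ => c)) :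
    3 * {f | Q f ∧ f a ≠ f b}.ncard = 2 * {f | Q f}.ncard := by
  have h := three_mul_card_filter_eq K ha hb Q hQ
  have h' := ncard_setOf_and_add_ncard_setOf_and_not (fun f : V → ZMod 3 => f a = f b) Q
  simp only [ne_eq]
  omega

/-- The number of maps to `ZMod 3` that take different values at the ends of each of the given
edges. -/
noncomputable def properCount {V : Type*} (E : Set (Sym2 V)) : ℕ :=
  {f : V → ZMod 3 | ∀ x y, s(x, y) ∈ E → f x ≠ f y}.ncard

theorem IsBridge.three_mul_properCount {V : Type*} [Fintype V] {H : SimpleGraph V} {e : Sym2 V}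
    (hb : H.IsBridge e) (he : e ∈ H.edgeSet) :
    3 * properCount H.edgeSet = 2 * properCount (H.deleteEdges {e}).edgeSet := by
  classical
  induction e with | h a b
  rw [isBridge_iff] at hb
  have h := three_mul_card_filter_ne {v | (H.deleteEdges {s(a, b)}).Reachable a v} (a := a)
    (b := b) (Reachable.refl a) hb
    (fun f => ∀ x y, s(x, y) ∈ (H.deleteEdges {s(a, b)}).edgeSet → f x ≠ f y) (by
      intro f c hf x y hxy
      have hiff : (H.deleteEdges {s(a, b)}).Reachable a x ↔
          (H.deleteEdges {s(a, b)}).Reachable a y :=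
        ⟨fun h => h.trans (Adj.reachable hxy), fun h => h.trans (Adj.reachable hxy).symm⟩
      by_cases hx : (H.deleteEdges {s(a, b)}).Reachable a x
      · have hy := hiff.1 hx
        simpa [Set.indicator, hx, hy] using hf x y hxy
      · have hy := mt hiff.2 hx
        simpa [Set.indicator, hx, hy] using hf x y hxy)
  have hT : properCount H.edgeSet = {f : V → ZMod 3 |
      (∀ x y, s(x, y) ∈ (H.deleteEdges {s(a, b)}).edgeSet → f x ≠ f y) ∧ f a ≠ f b}.ncard := by
    unfold properCount
    congr 1
    ext f
    rw [edgeSet_deleteEdges]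
    refine ⟨fun hf => ⟨fun x y hxy => hf x y hxy.1, hf a b he⟩, ?_⟩
    rintro ⟨hf, hab⟩ x y hxy
    by_cases h : s(x, y) = s(a, b)
    · rcases Sym2.eq_iff.1 h with ⟨rfl, rfl⟩ | ⟨rfl, rfl⟩
      exacts [hab, hab.symm]
    · exact hf x y ⟨hxy, h⟩
  rw [hT]
  exact h

theorem properCount_deleteEdges {V : Type*} [Fintype V] (H : SimpleGraph V) (s : Finset (Sym2 V))
    (hs : ∀ e ∈ s, H.IsBridge e) (hsub : ∀ e ∈ s, e ∈ H.edgeSet) :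
    3 ^ s.card * properCount H.edgeSet =
      2 ^ s.card * properCount (H.deleteEdges (s : Set (Sym2 V))).edgeSet := by
  classical
  induction s using Finset.induction_on with
  | empty => simp
  | insert e s he ih =>
    have ih := ih (fun e' he' => hs e' (Finset.mem_insert_of_mem he'))
      fun e' he' => hsub e' (Finset.mem_insert_of_mem he')
    have hb : (H.deleteEdges (s : Set (Sym2 V))).IsBridge e :=
      (hs e (Finset.mem_insert_self e s)).anti (deleteEdges_le _)
    have h := hb.three_mul_properCount (by
      rw [edgeSet_deleteEdges]
      exact ⟨hsub e (Finset.mem_insert_self e s), he⟩)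
    rw [deleteEdges_deleteEdges] at h
    rw [Finset.card_insert_of_notMem he, Finset.coe_insert, Set.insert_eq, Set.union_comm,
      pow_succ, pow_succ]
    linear_combination 3 * ih + 2 ^ s.card * h

theorem Walk.IsPath.card_proper {V : Type*} [Fintype V] {G : SimpleGraph V} {u v : V}
    (p : G.Walk u v) (hp : p.IsPath) :
    3 ^ p.length * properCount {e | e ∈ p.edges} = 2 ^ p.length * 3 ^ Fintype.card V ∧
    (3 : ℤ) ^ (p.length + 1) * {f : V → ZMod 3 |
      (∀ x y, s(x, y) ∈ p.edges → f x ≠ f y) ∧ f u = f v}.ncard =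
      3 ^ Fintype.card V * (2 ^ p.length + 2 * (-1) ^ p.length) := by
  induction p with
  | nil => 
    have hc : Nat.card (V → ZMod 3) = 3 ^ Fintype.card V := by
      classical
      rw [Nat.card_eq_fintype_card, Fintype.card_fun, ZMod.card]
    simp [properCount, hc]
    ring
  | @cons u u' v h p ih =>
    rw [cons_isPath_iff] at hp
    have hne : v ≠ u := fun e => hp.2 (e ▸ p.end_mem_support)
    have hinv : ∀ (f : V → ZMod 3) (c : ZMod 3), (∀ x y, s(x, y) ∈ p.edges → f x ≠ f y) →
        ∀ x y, s(x, y) ∈ p.edges → (f + Set.indicator {u} fun _ => c) x ≠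
          (f + Set.indicator {u} fun _ => c) y := by
      intro f c hf x y hxy
      have hx : x ∉ ({u} : Set V) := fun e => hp.2 (e ▸ p.fst_mem_support_of_mem_edges hxy)
      have hy : y ∉ ({u} : Set V) := fun e => hp.2 (e ▸ p.snd_mem_support_of_mem_edges hxy)
      simpa only [Pi.add_apply, Set.indicator_of_notMem hx, Set.indicator_of_notMem hy, add_zero]
        using hf x y hxy
    have hne' : u' ≠ u := h.ne'
    have h1 := three_mul_card_filter_ne {u} (a := u) (b := u') rfl hne' _ hinv
    have h2 := three_mul_card_filter_eq {u} (a := u) (b := v) rfl hne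
      (fun f => (∀ x y, s(x, y) ∈ p.edges → f x ≠ f y) ∧ f u' ≠ f v) (by
        intro f c hf
        refine ⟨hinv f c hf.1, ?_⟩
        simpa only [Pi.add_apply, add_zero, Set.indicator_of_notMem (show u' ∉ ({u} : Set V) from hne'),
          Set.indicator_of_notMem (show v ∉ ({u} : Set V) from hne)] using hf.2)
    have h3 := ncard_setOf_and_add_ncard_setOf_and_not (fun f : V → ZMod 3 => f u' = f v)
      (fun f => ∀ x y, s(x, y) ∈ p.edges → f x ≠ f y)
    obtain ⟨i1, i2⟩ := ih hp.1
    have hcons : ∀ f : V → ZMod 3, (∀ x y, s(x, y) ∈ (cons h p).edges → f x ≠ f y) ↔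
        (∀ x y, s(x, y) ∈ p.edges → f x ≠ f y) ∧ f u ≠ f u' := by
      intro f
      constructor
      · intro hf
        exact ⟨fun x y hxy => hf x y (by simp [hxy]), hf u u' (by simp)⟩
      · rintro ⟨hf, hu⟩ x y hxy
        rw [edges_cons, List.mem_cons, Sym2.eq_iff] at hxy
        rcases hxy with (⟨rfl, rfl⟩ | ⟨rfl, rfl⟩) | hxy
        exacts [hu, hu.symm, hf x y hxy]
    have hT : properCount {e | e ∈ (cons h p).edges} = {f : V → ZMod 3 |
        (∀ x y, s(x, y) ∈ p.edges → f x ≠ f y) ∧ f u ≠ f u'}.ncard := by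
      unfold properCount
      congr 1
      ext f
      exact hcons f
    have hS : {f : V → ZMod 3 |
        (∀ x y, s(x, y) ∈ (cons h p).edges → f x ≠ f y) ∧ f u = f v} =
        {f : V → ZMod 3 |
          ((∀ x y, s(x, y) ∈ p.edges → f x ≠ f y) ∧ f u' ≠ f v) ∧ f u = f v} := by
      ext f
      change (∀ x y, s(x, y) ∈ (cons h p).edges → f x ≠ f y) ∧ f u = f v ↔ (_ ∧ _) ∧ _
      rw [hcons]
      constructor
      · rintro ⟨⟨ha, hb⟩, hc⟩
        exact ⟨⟨ha, fun h => hb (hc.trans h.symm)⟩, hc⟩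
      · rintro ⟨⟨ha, hb⟩, hc⟩
        exact ⟨⟨ha, fun h => hb (h.symm.trans hc)⟩, hc⟩
    rw [hT, hS, length_cons]
    change _ = 2 * properCount {e | e ∈ p.edges} at h1
    change _ = properCount {e | e ∈ p.edges} at h3
    clear hcons hT hS hinv
    simp only [ne_eq] at *
    zify at h1 h2 h3 i1 ⊢
    constructor
    · rw [pow_succ, pow_succ]
      linear_combination 3 ^ p.length * h1 + 2 * i1
    · simp only [pow_succ] at i2 ⊢
      linear_combination 3 * 3 ^ p.length * h2 + 3 * 3 ^ p.length * h3 + 3 * i1 - i2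

theorem Walk.IsCycle.properCount_edges {V : Type*} [Fintype V] {G : SimpleGraph V} {u : V}
    {w : G.Walk u u} (hw : w.IsCycle) :
    (3 : ℤ) ^ w.length * properCount {e | e ∈ w.edges} =
      3 ^ Fintype.card V * (2 ^ w.length + 2 * (-1) ^ w.length) := by
  cases w with
  | nil => exact absurd hw (by simp)
  | @cons _ v _ h p =>
    rw [cons_isCycle_iff] at hw
    obtain ⟨i1, i2⟩ := hw.1.card_proper
    have h3 := ncard_setOf_and_add_ncard_setOf_and_not (fun f : V → ZMod 3 => f v = f u)
      (fun f => ∀ x y, s(x, y) ∈ p.edges → f x ≠ f y)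
    have hT : properCount {e | e ∈ (cons h p).edges} = {f : V → ZMod 3 |
        (∀ x y, s(x, y) ∈ p.edges → f x ≠ f y) ∧ ¬ f v = f u}.ncard := by
      unfold properCount
      congr 1
      ext f
      constructor
      · intro hf
        exact ⟨fun x y hxy => hf x y (by simp [hxy]), hf v u (by simp)⟩
      · rintro ⟨hf, hu⟩ x y hxy
        rw [Set.mem_ofPred_eq, edges_cons, List.mem_cons, Sym2.eq_iff] at hxy
        rcases hxy with (⟨rfl, rfl⟩ | ⟨rfl, rfl⟩) | hxy
        exacts [fun h => hu h.symm, hu, hf x y hxy]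
    rw [hT, length_cons]
    change _ = properCount {e | e ∈ p.edges} at h3
    zify at h3 i1
    simp only [pow_succ] at i2 ⊢
    linear_combination 3 * 3 ^ p.length * h3 + 3 * i1 - i2

theorem IsUnicyclic.pow_mul_properCount {V : Type*} [Fintype V] {G : SimpleGraph V}
    (hconn : G.Connected) (huni : G.IsUnicyclic) {C : G.Subgraph} (hC : C.IsCycleSubgraph) :
    (2 : ℤ) ^ C.verts.ncard * properCount G.edgeSet =
      2 ^ Fintype.card V * (2 ^ C.verts.ncard + 2 * (-1) ^ C.verts.ncard) := by
  classical
  have hex := hC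
  obtain ⟨u, w, hw, rfl⟩ := hC
  have huniq : ∀ {v : V} (w' : G.Walk v v), w'.IsCycle → w'.toSubgraph = w.toSubgraph :=
    fun w' hw' => huni.unique ⟨_, w', hw', rfl⟩ hex
  have hmem : ∀ {v : V} (w' : G.Walk v v), w'.IsCycle → ∀ e ∈ w.edges, e ∈ w'.edges := by
    intro v w' hw' e he
    rw [← Walk.mem_edges_toSubgraph, huniq w' hw', Walk.mem_edges_toSubgraph]
    exact he
  have hlen : w.toSubgraph.verts.ncard = w.length := by
    have h1 : w.toSubgraph.verts = (w.support.tail.toFinset : Set V) := by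
      ext x
      rw [Walk.mem_verts_toSubgraph, Finset.mem_coe, List.mem_toFinset, ← w.cons_tail_support,
        List.mem_cons, List.tail_cons]
      exact ⟨fun h => h.elim (fun h => h ▸ w.end_mem_tail_support hw.not_nil) id, Or.inr⟩
    rw [h1, Set.ncard_coe_finset, List.toFinset_card_of_nodup hw.support_nodup, List.length_tail,
      Walk.length_support, Nat.add_sub_cancel]
  have hwcard : w.edges.toFinset.card = w.length := by
    rw [List.toFinset_card_of_nodup hw.isTrail.edges_nodup, Walk.length_edges]
  have hsub : w.edges.toFinset ⊆ G.edgeFinset := fun e he =>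
    mem_edgeFinset.2 (w.edges_subset_edgeSet (List.mem_toFinset.1 he))
  have hle : w.length ≤ G.edgeFinset.card := hwcard ▸ Finset.card_le_card hsub
  have hcard : G.edgeFinset.card = Fintype.card V := by
    obtain ⟨e, he⟩ : ∃ e, e ∈ w.edges := List.exists_mem_of_ne_nil _ (by
      rw [ne_eq, Walk.edges_eq_nil]
      exact hw.not_nil)
    have heG := w.edges_subset_edgeSet he
    have htree : (G.deleteEdges {e}).IsTree := by
      refine ⟨?_, fun v c hc => ?_⟩
      · induction e with | h x y
        refine hconn.connected_delete_edge_of_not_isBridge fun hb => ?_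
        exact hb.notMem_edges_of_isCycle hw he
      · have h1 := hmem _ (hc.mapLe (deleteEdges_le {e})) e he
        rw [Walk.edges_mapLe_eq_edges] at h1
        have h2 := c.edges_subset_edgeSet h1
        rw [edgeSet_deleteEdges] at h2
        exact h2.2 rfl
    rw [← htree.card_edgeFinset, ← Finset.card_erase_add_one (mem_edgeFinset.2 heG)]
    congr 2
    ext e'
    simp [and_comm]
  have hdel := properCount_deleteEdges G (G.edgeFinset \ w.edges.toFinset)
    (by
      intro e he
      rw [Finset.mem_sdiff, mem_edgeFinset, List.mem_toFinset] at he
      rw [isBridge_iff_forall_cycle_notMem he.1]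
      intro v w' hw' he'
      rw [← Walk.mem_edges_toSubgraph, huniq w' hw', Walk.mem_edges_toSubgraph] at he'
      exact he.2 he')
    (fun e he => mem_edgeFinset.1 (Finset.mem_sdiff.1 he).1)
  have hset : (G.deleteEdges ((G.edgeFinset \ w.edges.toFinset : Finset (Sym2 V)) :
      Set (Sym2 V))).edgeSet = {e | e ∈ w.edges} := by
    ext e
    have := @w.edges_subset_edgeSet _ _ _ _ e
    simp
    tauto
  have hcyc := hw.properCount_edges
  rw [hset, Finset.card_sdiff_of_subset hsub, hwcard, hcard] at hdel
  rw [hcard] at hle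
  rw [hlen]
  obtain ⟨m, hm⟩ := Nat.exists_eq_add_of_le hle
  rw [hm, Nat.add_sub_cancel_left] at hdel
  rw [hm] at hcyc ⊢
  zify at hdel
  have h3 : (3 : ℤ) ^ (w.length + m) ≠ 0 := by positivity
  apply mul_left_cancel₀ h3
  simp only [pow_add] at *
  linear_combination 2 ^ w.length * 3 ^ w.length * hdel + 2 ^ w.length * 2 ^ m * hcyc

theorem support_colorExponent {V : Type*} [Fintype V] {G : SimpleGraph V} (κ : G.Coloring ℕ)
    (i : ℕ) : colorExponent κ i ≠ 0 ↔ ∃ v, κ v = i := by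
  simp [colorExponent, Finsupp.finsetSum_apply, Finsupp.single_apply]

theorem degree_colorExponent {V : Type*} [Fintype V] {G : SimpleGraph V} (κ : G.Coloring ℕ) :
    (colorExponent κ).degree = Fintype.card V := by
  simp [colorExponent, map_sum, Finsupp.degree_single]

theorem exists_equiv_coloring {V₁ V₂ : Type*} [Fintype V₁] [Fintype V₂]
    {G₁ : SimpleGraph V₁} {G₂ : SimpleGraph V₂}
    (h : G₁.chromaticSymmetricFunction = G₂.chromaticSymmetricFunction) :
    ∃ e : G₁.Coloring ℕ ≃ G₂.Coloring ℕ, ∀ κ, colorExponent (e κ) = colorExponent κ := by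
  have hd : ∀ d, Nonempty ({κ : G₁.Coloring ℕ // colorExponent κ = d} ≃
      {κ : G₂.Coloring ℕ // colorExponent κ = d}) := by
    intro d
    have := finite_colorings_of_colorExponent G₁ d
    have := finite_colorings_of_colorExponent G₂ d
    exact Finite.card_eq.1 (Nat.cast_injective (R := ℚ) (congrFun h d))
  have E := fun d => (hd d).some
  refine ⟨Equiv.ofFiberEquiv E, fun κ => Equiv.ofFiberEquiv_map E κ⟩

theorem properCount_eq_card {V : Type*} [Fintype V] (G : SimpleGraph V) :
    properCount G.edgeSet = Nat.card {κ : G.Coloring ℕ // ∀ i, colorExponent κ i ≠ 0 → i < 3} := by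
  rw [properCount, ← Nat.card_coe_set_eq]
  refine Nat.card_congr
    { toFun f := ⟨Coloring.mk (fun v => (f.1 v).val)
        fun {x y} hxy h => f.2 x y hxy (ZMod.val_injective 3 h), ?_⟩
      invFun κ := ⟨fun v => (κ.1 v : ZMod 3), ?_⟩
      left_inv := ?_
      right_inv := ?_ }
  · intro i hi
    obtain ⟨v, rfl⟩ := (support_colorExponent _ _).1 hi
    exact ZMod.val_lt (f.1 v)
  · intro x y hxy h
    have hx := κ.2 _ ((support_colorExponent _ _).2 ⟨x, rfl⟩)
    have hy := κ.2 _ ((support_colorExponent _ _).2 ⟨y, rfl⟩)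
    have := congrArg ZMod.val h
    rw [ZMod.val_cast_of_lt hx, ZMod.val_cast_of_lt hy] at this
    exact κ.1.valid hxy this
  · intro f
    ext v
    exact ZMod.natCast_zmod_val (f.1 v)
  · intro κ
    ext v
    exact ZMod.val_cast_of_lt (κ.2 _ ((support_colorExponent _ _).2 ⟨v, rfl⟩))

end SimpleGraph

open SimpleGraph in
theorem mainTheorem7 {V₁ V₂ : Type*} [Fintype V₁] [Fintype V₂]
    (G₁ : SimpleGraph V₁) (G₂ : SimpleGraph V₂)
    (hconn₁ : G₁.Connected) (hconn₂ : G₂.Connected)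
    (huni₁ : G₁.IsUnicyclic) (huni₂ : G₂.IsUnicyclic)
    (C₁ : G₁.Subgraph) (C₂ : G₂.Subgraph)
    (hC₁ : C₁.IsCycleSubgraph) (hC₂ : C₂.IsCycleSubgraph)
    (hsize : C₁.verts.ncard ≠ C₂.verts.ncard) :
    G₁.chromaticSymmetricFunction ≠ G₂.chromaticSymmetricFunction := by
  intro h
  obtain ⟨e, he⟩ := exists_equiv_coloring h
  have hn : Fintype.card V₁ = Fintype.card V₂ := by
    let κ : G₁.Coloring ℕ := Coloring.mk (fun v => (Fintype.equivFin V₁ v : ℕ))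
      fun hxy h => hxy.ne ((Fintype.equivFin V₁).injective (Fin.ext h))
    rw [← degree_colorExponent κ, ← he κ, degree_colorExponent]
  have hcount : properCount G₁.edgeSet = properCount G₂.edgeSet := by
    rw [properCount_eq_card, properCount_eq_card]
    exact Nat.card_congr (e.subtypeEquiv fun κ => by rw [he κ])
  have h₁ := huni₁.pow_mul_properCount hconn₁ hC₁
  have h₂ := huni₂.pow_mul_properCount hconn₂ hC₂
  rw [hcount, hn] at h₁
  generalize C₁.verts.ncard = k at *
  generalize C₂.verts.ncard = l at *
  have hkl : (2 : ℤ) ^ l * (-1) ^ k = 2 ^ k * (-1) ^ l := by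
    have h0 : (2 : ℤ) ^ Fintype.card V₂ * 2 ≠ 0 := by positivity
    apply mul_left_cancel₀ h0
    linear_combination 2 ^ k * h₂ - 2 ^ l * h₁
  have habs := congrArg Int.natAbs hkl
  simp only [Int.natAbs_mul, Int.natAbs_pow, Int.natAbs_neg, Int.natAbs_one, one_pow,
    mul_one] at habs
  exact hsize (Nat.pow_right_injective le_rfl habs).symm
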